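/- For $k\in\mathbb{N}=\{0,1,2,\dots\}$, say that $k$ is the index of a prime number if $2k+3$ is prime. Let $k\ge 1$ be an integer. Then $k$ is the index of a prime number if and only if $2k+3$ is squarefree and one of the following three conditions holds: (a) $k\equiv 1$ or $5 \pmod 6$, and the equation $k = 2x^2+\frac{y^2-3}{2}$ has an odd number of solutions $(x,y)\in\mathbb{N}^2$; (b) $k\equiv 2 \pmod 6$, and the equation $k=\frac{3x^2+y^2-3}{2}$ has an odd number of solutions $(x,y)\in\mathbb{N}^2$; (c) $k\equiv 4 \pmod 6$, and the equation $k=\frac{3x^2-y^2-3}{2}$ has an odd number of solutions $(x,y)\in\mathbb{N}^2$ with $y<x$. -/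

import Mathlib

/-- `k` is the index of a prime number: the odd number `2 * k + 3` with index `k` is prime. -/
def IsPrimeIndex (k : ℕ) : Prop := Nat.Prime (2 * k + 3)

/-! Put `n = 2 * k + 3`. The three equations say that `±n = y² - D x²` with `D = -4`, `-3`, `3`, and
the classes of `k` say that `n` is prime to 3 and congruent to 1 mod 4, 7 mod 12, 11 mod 12
respectively. A representation gives the two square roots `±y/x` of `D` modulo `n`. Every root
arises from exactly one representation, so there are twice as many roots as representations
(`card_sqrt_eq_two_mul`). For odd squarefree `n`, the Chinese remainder theorem makes the number of
roots a multiple of 4 when `n` is composite, while reciprocity makes it 2 when `n` is prime. Hence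
the number of representations is odd exactly for primes (`prime_iff_odd_ncard`). Existence comes
from Thue's lemma, which gives `y² - D x² = n c` with few possible `c`; uniqueness comes from
composition of forms. -/

/-- Thue's lemma: every residue class modulo a squarefree `n > 1` is a quotient `y / x` of integers
of absolute value less than `√n`. -/
theorem exists_small_quotient {n : ℕ} (hn : 1 < n) (hsq : Squarefree n) (t : ZMod n) :
    ∃ x y : ℤ, 0 < x ∧ x ^ 2 < n ∧ y ^ 2 < n ∧ (y : ZMod n) = t * x := by
  have : NeZero n := ⟨by omega⟩
  set m := Nat.sqrt n with hm
  -- A squarefree `n > 1` is not a square, so the bounds below are strict.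
  have hlt : m * m < n := by
    refine lt_of_le_of_ne (Nat.sqrt_le n) fun h => ?_
    have hu := Nat.isUnit_iff.1 (hsq m ⟨1, by rw [mul_one, h]⟩)
    rw [hu] at h
    omega
  have hcard : Fintype.card (ZMod n) < Fintype.card (Fin (m + 1) × Fin (m + 1)) := by
    rw [ZMod.card, Fintype.card_prod, Fintype.card_fin]
    exact Nat.lt_succ_sqrt n
  obtain ⟨⟨a, b⟩, ⟨c, d⟩, hne, heq⟩ := Fintype.exists_ne_map_eq_of_card_lt
    (fun p : Fin (m + 1) × Fin (m + 1) => ((p.2 : ℕ) : ZMod n) - t * ((p.1 : ℕ) : ZMod n)) hcard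
  have small : ∀ i j : Fin (m + 1), (((i : ℕ) : ℤ) - (j : ℕ)) ^ 2 < n := fun i j => by
    have hi := i.2
    have hj := j.2
    have : (((i : ℕ) : ℤ) - (j : ℕ)) ^ 2 ≤ (m : ℤ) ^ 2 := sq_le_sq' (by omega) (by omega)
    have : ((m * m : ℕ) : ℤ) < n := by exact_mod_cast hlt
    push_cast at this
    linarith
  have hac : (a : ℕ) ≠ c := fun h => by
    refine hne (Prod.ext (Fin.ext h) (Fin.ext ?_))
    have hbd : ((b : ℕ) : ZMod n) = ((d : ℕ) : ZMod n) := by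
      simp only [h] at heq
      exact sub_left_injective heq
    have hmn : m < n := by nlinarith
    rwa [ZMod.natCast_eq_natCast_iff', Nat.mod_eq_of_lt (by have := b.2; omega),
      Nat.mod_eq_of_lt (by have := d.2; omega)] at hbd
  rcases lt_or_gt_of_ne hac with h | h
  · refine ⟨(c : ℕ) - (a : ℕ), (d : ℕ) - (b : ℕ), by omega, small _ _, small _ _, ?_⟩
    push_cast
    linear_combination -heq
  · refine ⟨(a : ℕ) - (c : ℕ), (b : ℕ) - (d : ℕ), by omega, small _ _, small _ _, ?_⟩
    push_cast
    linear_combination heq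

/-! ### Counting square roots modulo `n` -/

/-- Modulo an odd `n > 1`, a unit has an even number of square roots. -/
theorem even_card_sqrt {n : ℕ} (hn : 1 < n) (hodd : Odd n) {D : ZMod n} (hD : IsUnit D) :
    Even (Nat.card {t : ZMod n // t ^ 2 = D}) := by
  have : NeZero n := ⟨by omega⟩
  have : Fact (1 < n) := ⟨hn⟩
  have h2 : IsUnit (2 : ZMod n) := by
    have := (ZMod.isUnit_iff_coprime 2 n).2 (Nat.coprime_two_left.2 hodd)
    simpa using this
  -- The count is taken in `ZMod 2`, where the fixed-point-free involution `t ↦ -t` cancels it.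
  rw [Nat.card_eq_fintype_card, Fintype.card_subtype, even_iff_two_dvd,
    ← ZMod.natCast_eq_zero_iff, Finset.card_eq_sum_ones, Nat.cast_sum]
  refine Finset.sum_involution (fun t _ => -t) (fun _ _ => by decide) (fun t ht _ h => ?_)
    (fun t ht => by simpa using ht) (fun t _ => neg_neg t)
  have ht : t ^ 2 = D := by simpa using ht
  have htu : IsUnit t := (isUnit_pow_iff two_ne_zero).1 (ht ▸ hD)
  have h0 : 2 * t = 0 := by linear_combination -h
  exact (h2.mul htu).ne_zero h0

/-- Modulo an odd squarefree `n > 1` which is not a prime, the number of square roots of an integer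
coprime to `n` is divisible by `4`. -/
theorem four_dvd_card_sqrt {n : ℕ} (hn : 1 < n) (hodd : Odd n) (hsq : Squarefree n)
    (hp : ¬ n.Prime) {D : ℤ} (hD : IsUnit (D : ZMod n)) :
    4 ∣ Nat.card {t : ZMod n // t ^ 2 = (D : ZMod n)} := by
  obtain ⟨b, hb⟩ := Nat.minFac_dvd n
  set a := n.minFac with ha
  have hpa : a.Prime := Nat.minFac_prime (by omega)
  have hb1 : 1 < b := by
    rcases Nat.lt_or_ge 1 b with h | h
    · exact h
    · interval_cases b
      · omega
      · exact absurd (by rwa [hb, mul_one]) hp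
  clear_value a
  subst hb
  have hcop : a.Coprime b := Nat.coprime_of_squarefree_mul hsq
  have hodd' := Nat.odd_mul.1 hodd
  let e := ZMod.chineseRemainder hcop
  have he : ((D : ZMod a), (D : ZMod b)) = e D := by
    rw [map_intCast]; rfl
  have hu : IsUnit ((D : ZMod a), (D : ZMod b)) := he ▸ hD.map e
  have hu' := Prod.isUnit_iff.1 hu
  have hequiv : {t : ZMod (a * b) // t ^ 2 = (D : ZMod (a * b))} ≃
      {t : ZMod a // t ^ 2 = (D : ZMod a)} × {t : ZMod b // t ^ 2 = (D : ZMod b)} :=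
    (e.toEquiv.subtypeEquiv (q := fun z => z.1 ^ 2 = (D : ZMod a) ∧ z.2 ^ 2 = (D : ZMod b))
      fun t => by
        rw [← e.injective.eq_iff, map_pow, ← he, Prod.ext_iff]; rfl).trans
      (Equiv.subtypeProdEquivProd (p := fun z : ZMod a => z ^ 2 = (D : ZMod a))
        (q := fun z : ZMod b => z ^ 2 = (D : ZMod b)))
  rw [Nat.card_congr hequiv, Nat.card_prod]
  exact mul_dvd_mul (even_card_sqrt hpa.one_lt hodd'.1 hu'.1).two_dvd
    (even_card_sqrt hb1 hodd'.2 hu'.2).two_dvd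

/-- Modulo an odd prime, a nonzero square has exactly two square roots. -/
theorem card_sqrt_prime {p : ℕ} (hp : p.Prime) (hp2 : p ≠ 2) {D : ℤ} (hD : IsUnit (D : ZMod p))
    (hsquare : IsSquare (D : ZMod p)) :
    Nat.card {t : ZMod p // t ^ 2 = (D : ZMod p)} = 2 := by
  have : Fact p.Prime := ⟨hp⟩
  have h := legendreSym.card_sqrts p hp2 D
  rw [(legendreSym.eq_one_iff p hD.ne_zero).2 hsquare, Set.toFinset_card] at h
  rw [Nat.card_eq_fintype_card]
  exact_mod_cast h

/-! ### Square roots and representations -/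

/-- If `n` is squarefree and `±n = y² - D x²`, then `x` is a unit modulo `n`. -/
theorem isUnit_of_represents {n : ℕ} (hsq : Squarefree n) {D s : ℤ} {x y : ℕ}
    (h : s * n = y ^ 2 - D * x ^ 2) (hs : s ^ 2 = 1) : IsUnit (x : ZMod n) := by
  rw [ZMod.isUnit_iff_coprime]
  refine Nat.coprime_of_dvd fun p hp hpx hpn => ?_
  obtain ⟨c, rfl⟩ := hpx
  have hpn' : (p : ℤ) ∣ n := by exact_mod_cast hpn
  have hy : (p : ℤ) ∣ (y : ℤ) ^ 2 := by
    have : (y : ℤ) ^ 2 = s * n + p * (D * p * c ^ 2) := by rw [h]; push_cast; ring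
    rw [this]
    exact dvd_add (hpn'.mul_left _) (dvd_mul_right _ _)
  have hy' : p ∣ y := hp.dvd_of_dvd_pow (n := 2) (by exact_mod_cast hy)
  obtain ⟨d, rfl⟩ := hy'
  have : ((p * p : ℕ) : ℤ) ∣ n := ⟨s * (d ^ 2 - D * c ^ 2), by
    push_cast at h ⊢; linear_combination s * h - n * hs⟩
  exact hp.one_lt.ne' (Nat.isUnit_iff.1 (hsq p (by exact_mod_cast this)))

/-- The number of square roots of `D` modulo `n` is twice the number of representations of `±n` by
`y² - D x²` in a set `P` of representations which contains, for every square root `t` of `D`,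
exactly one pair with `y = ± t x`. -/
theorem card_sqrt_eq_two_mul {n : ℕ} (hn : 1 < n) (hodd : Odd n) (hsq : Squarefree n) {D s : ℤ}
    (hD : IsUnit (D : ZMod n)) (hs : s ^ 2 = 1) {P : Set (ℕ × ℕ)}
    (hP : ∀ p ∈ P, s * n = (p.2 : ℤ) ^ 2 - D * (p.1 : ℤ) ^ 2)
    (hinj : ∀ p ∈ P, ∀ q ∈ P, ∀ e : ℤ, e ^ 2 = 1 →
      (n : ℤ) ∣ p.2 * q.1 - e * q.2 * p.1 → (p.2 * q.1 : ℤ) = e * q.2 * p.1)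
    (hsurj : ∀ t : ZMod n, t ^ 2 = D →
      ∃ p ∈ P, (p.2 : ZMod n) = t * p.1 ∨ (p.2 : ZMod n) = -t * p.1) :
    Nat.card {t : ZMod n // t ^ 2 = (D : ZMod n)} = 2 * P.ncard := by
  have : Fact (1 < n) := ⟨hn⟩
  have h2 : IsUnit (2 : ZMod n) := by
    have := (ZMod.isUnit_iff_coprime 2 n).2 (Nat.coprime_two_left.2 hodd)
    simpa using this
  have hunit : ∀ p ∈ P, IsUnit (p.1 : ZMod n) := fun p hp => isUnit_of_represents hsq (hP p hp) hs
  have hmod : ∀ p ∈ P, (p.2 : ZMod n) ^ 2 = D * (p.1 : ZMod n) ^ 2 := fun p hp => by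
    have := congrArg (Int.cast : ℤ → ZMod n) (hP p hp)
    push_cast at this
    rw [ZMod.natCast_self, mul_zero] at this
    linear_combination -this
  let sgn : Bool → ℤ := fun b => if b then 1 else -1
  have hsgn : ∀ b, sgn b ^ 2 = 1 := by intro b; cases b <;> rfl
  let f : P × Bool → {t : ZMod n // t ^ 2 = (D : ZMod n)} := fun z =>
    ⟨sgn z.2 * (z.1.1.2 * (z.1.1.1 : ZMod n)⁻¹), by
      have h1 := ZMod.mul_inv_of_unit _ (hunit _ z.1.2)
      have h3 := congrArg (Int.cast : ℤ → ZMod n) (hsgn z.2)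
      push_cast at h3
      rw [mul_pow, h3, one_mul, mul_pow, hmod _ z.1.2, mul_assoc, ← mul_pow, h1, one_pow, mul_one]⟩
  have hf : Function.Bijective f := by
    constructor
    · rintro ⟨⟨p, hp⟩, b⟩ ⟨⟨q, hq⟩, c⟩ h
      have h := Subtype.ext_iff.1 h
      simp only [f] at h
      have hp1 := ZMod.mul_inv_of_unit _ (hunit _ hp)
      have hq1 := ZMod.mul_inv_of_unit _ (hunit _ hq)
      have hb := congrArg (Int.cast : ℤ → ZMod n) (hsgn b)
      push_cast at hb
      have hcross : (p.2 : ZMod n) * q.1 = sgn b * sgn c * q.2 * p.1 := by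
        linear_combination (sgn b * p.1 * q.1 : ZMod n) * h
          - (sgn b ^ 2 * p.2 * q.1 : ZMod n) * hp1 + (sgn b * sgn c * q.2 * p.1 : ZMod n) * hq1
          - (p.2 * q.1 : ZMod n) * hb
      have hdvd : (n : ℤ) ∣ p.2 * q.1 - sgn b * sgn c * q.2 * p.1 := by
        rw [← ZMod.intCast_zmod_eq_zero_iff_dvd]
        push_cast
        rw [hcross, sub_self]
      have heq := hinj p hp q hq (sgn b * sgn c) (by rw [mul_pow, hsgn, hsgn, one_mul]) hdvd
      -- Proportional pairs with the same nonzero value `s * n` agree up to sign.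
      have hsq1 : (p.1 : ℤ) ^ 2 = (q.1 : ℤ) ^ 2 := by
        have h5 : (p.2 * q.1 : ℤ) ^ 2 = (q.2 * p.1 : ℤ) ^ 2 := by
          rw [heq]; linear_combination (q.2 * p.1 : ℤ) ^ 2 * (sgn c ^ 2 * hsgn b + hsgn c)
        have h6 : s * n * ((p.1 : ℤ) ^ 2 - (q.1 : ℤ) ^ 2) = 0 := by
          linear_combination (p.1 : ℤ) ^ 2 * hP q hq - (q.1 : ℤ) ^ 2 * hP p hp - h5
        have h7 : s ≠ 0 := by rintro rfl; norm_num at hs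
        have h8 : (n : ℤ) ≠ 0 := by omega
        rcases mul_eq_zero.1 h6 with h | h
        · exact absurd h (mul_ne_zero h7 h8)
        · linarith
      have e1 : p.1 = q.1 := by
        have := Nat.pow_left_injective two_ne_zero (by exact_mod_cast hsq1 : p.1 ^ 2 = q.1 ^ 2)
        exact this
      have e2 : p.2 = q.2 := by
        have h3 := hP p hp
        rw [e1] at h3
        have h4 : (p.2 : ℤ) ^ 2 = (q.2 : ℤ) ^ 2 := by linarith [hP q hq]
        exact Nat.pow_left_injective two_ne_zero (by exact_mod_cast h4 : p.2 ^ 2 = q.2 ^ 2)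
      obtain rfl : p = q := Prod.ext e1 e2
      have hne : (p.2 : ZMod n) * (p.1 : ZMod n)⁻¹ * 2 ≠ 0 := by
        have hu : IsUnit (p.2 : ZMod n) :=
          (isUnit_pow_iff two_ne_zero).1 (hmod p hp ▸ hD.mul ((hunit p hp).pow 2))
        exact ((hu.mul (IsUnit.of_mul_eq_one_right _ hp1)).mul h2).ne_zero
      have hbc : b = c := by
        cases b <;> cases c <;> simp only [sgn] at h <;> first | rfl | (push_cast at h; exfalso)
        · exact hne (by simp at h; linear_combination -h)
        · exact hne (by simp at h; linear_combination h)
      rw [hbc]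
    · rintro ⟨t, ht⟩
      obtain ⟨p, hp, h | h⟩ := hsurj t ht
      · refine ⟨(⟨p, hp⟩, true), Subtype.ext ?_⟩
        have hp1 := ZMod.mul_inv_of_unit _ (hunit _ hp)
        simp only [f, sgn, h]
        simp [mul_assoc, hp1]
      · refine ⟨(⟨p, hp⟩, false), Subtype.ext ?_⟩
        have hp1 := ZMod.mul_inv_of_unit _ (hunit _ hp)
        simp only [f, sgn, h]
        simp [mul_assoc, hp1]
  rw [← Nat.card_congr (Equiv.ofBijective f hf), Nat.card_prod, mul_comm, Nat.card_coe_set_eq]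
  simp

/-- Under the hypotheses of `card_sqrt_eq_two_mul`, the number of representations is odd if and only
if `n` is prime, provided that `D` is a square modulo `n` when `n` is prime. -/
theorem prime_iff_odd_ncard {n : ℕ} (hn : 1 < n) (hodd : Odd n) (hsq : Squarefree n) {D s : ℤ}
    (hD : IsCoprime D n) (hs : s ^ 2 = 1) {P : Set (ℕ × ℕ)}
    (hP : ∀ p ∈ P, s * n = (p.2 : ℤ) ^ 2 - D * (p.1 : ℤ) ^ 2)
    (hinj : ∀ p ∈ P, ∀ q ∈ P, ∀ e : ℤ, e ^ 2 = 1 →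
      (n : ℤ) ∣ p.2 * q.1 - e * q.2 * p.1 → (p.2 * q.1 : ℤ) = e * q.2 * p.1)
    (hsurj : ∀ t : ZMod n, t ^ 2 = D →
      ∃ p ∈ P, (p.2 : ZMod n) = t * p.1 ∨ (p.2 : ZMod n) = -t * p.1)
    (hsquare : n.Prime → IsSquare (D : ZMod n)) :
    n.Prime ↔ Odd P.ncard := by
  have hDu : IsUnit (D : ZMod n) := (ZMod.coe_int_isUnit_iff_isCoprime D n).2 hD.symm
  have h := card_sqrt_eq_two_mul hn hodd hsq hDu hs hP hinj hsurj
  constructor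
  · intro hp
    rw [card_sqrt_prime hp (by rintro rfl; exact absurd hodd (by decide)) hDu (hsquare hp)] at h
    rw [show P.ncard = 1 by omega]
    exact odd_one
  · intro ho
    by_contra hp
    have h4 := four_dvd_card_sqrt hn hodd hsq hp hDu
    obtain ⟨c, hc⟩ := ho
    omega

/-! ### Uniqueness of the representation attached to a root -/

/-- Composition gives `n² = (yv - Dxu)² - D(yu - vx)²`; a nonzero multiple of `n` as `yu - vx` would
make the right side at least `2n²`. -/
theorem eq_of_dvd_of_definite {n : ℕ} {D : ℤ} (hn : 1 < n) (hD : D ≤ -2) {x y u v : ℤ}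
    (h1 : (n : ℤ) = y ^ 2 - D * x ^ 2) (h2 : (n : ℤ) = v ^ 2 - D * u ^ 2)
    (h : (n : ℤ) ∣ y * u - v * x) : y * u = v * x := by
  obtain ⟨B, hB⟩ := h
  have hn2 : (0 : ℤ) < (n : ℤ) ^ 2 := by positivity
  have key : (n : ℤ) ^ 2 = (y * v - D * (x * u)) ^ 2 - D * (n ^ 2 * B ^ 2) := by
    rw [← mul_pow, ← hB]
    calc (n : ℤ) ^ 2 = (y ^ 2 - D * x ^ 2) * (v ^ 2 - D * u ^ 2) := by rw [← h1, ← h2, sq]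
      _ = _ := by ring
  have hB0 : B = 0 := by
    by_contra hB0
    have : 1 ≤ B ^ 2 := by have := sq_nonneg B; have := pow_ne_zero 2 hB0; omega
    nlinarith [sq_nonneg (y * v - D * (x * u)), mul_nonneg hn2.le (sub_nonneg.2 this)]
  rw [hB0] at hB
  linarith

/-- Here `(3xu - yv)² = n² + 3(yu - vx)²`, and the bounds on `y`, `v` force `2|yu - vx| < 3xu - yv`.
Together these give `|yu - vx| < n`. -/
theorem eq_of_dvd_of_three {n : ℕ} (hn : 1 < n) {x y u v : ℤ}
    (h1 : (n : ℤ) = 3 * x ^ 2 - y ^ 2) (h2 : (n : ℤ) = 3 * u ^ 2 - v ^ 2)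
    (hy : |y| < x) (hv : |v| < u) (h : (n : ℤ) ∣ y * u - v * x) : y * u = v * x := by
  obtain ⟨B, hB⟩ := h
  obtain ⟨hy1, hy2⟩ := abs_lt.1 hy
  obtain ⟨hv1, hv2⟩ := abs_lt.1 hv
  have hn2 : (0 : ℤ) < (n : ℤ) ^ 2 := by positivity
  have key : (3 * (x * u) - y * v) ^ 2 = n ^ 2 + 3 * (y * u - v * x) ^ 2 := by
    calc _ = (3 * x ^ 2 - y ^ 2) * (3 * u ^ 2 - v ^ 2) + 3 * (y * u - v * x) ^ 2 := by ring
      _ = _ := by rw [← h1, ← h2]; ring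
  have hpos : 0 < x * u := mul_pos (by linarith) (by linarith)
  have ineq : (2 * (y * u - v * x)) ^ 2 < (3 * (x * u) - y * v) ^ 2 := by
    apply sq_lt_sq'
    · nlinarith [mul_pos (sub_pos.2 hv2) (by linarith : 0 < x + y)]
    · nlinarith [mul_pos (sub_pos.2 hy2) (by linarith : 0 < u + v)]
  have hB0 : B = 0 := by
    by_contra hB0
    have : 1 ≤ B ^ 2 := by have := sq_nonneg B; have := pow_ne_zero 2 hB0; omega
    rw [hB] at key ineq
    nlinarith [mul_nonneg hn2.le (sub_nonneg.2 this)]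
  rw [hB0] at hB
  linarith

/-! ### Existence of representations -/

/-- A squarefree `n > 1` divides a form `y² - D x²` at a small pair, for every root of `D`. -/
theorem exists_small_multiple {n : ℕ} (hn : 1 < n) (hsq : Squarefree n) {D : ℤ} {t : ZMod n}
    (ht : t ^ 2 = D) : ∃ (x y : ℕ) (c : ℤ), 0 < x ∧ (x : ℤ) ^ 2 < n ∧ (y : ℤ) ^ 2 < n ∧
      ((y : ZMod n) = t * x ∨ (y : ZMod n) = -t * x) ∧ (y : ℤ) ^ 2 - D * (x : ℤ) ^ 2 = n * c := by
  obtain ⟨x, y, hx, hxn, hyn, h⟩ := exists_small_quotient hn hsq t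
  obtain ⟨c, hc⟩ : (n : ℤ) ∣ y ^ 2 - D * x ^ 2 := by
    rw [← ZMod.intCast_zmod_eq_zero_iff_dvd]
    push_cast
    rw [h, ← ht]
    ring
  lift x to ℕ using hx.le
  refine ⟨x, y.natAbs, c, by exact_mod_cast hx, hxn, by rwa [Int.natAbs_sq], ?_,
    by rwa [Int.natAbs_sq]⟩
  have h' : (y : ZMod n) = t * x := by exact_mod_cast h
  rcases Int.natAbs_eq y with hy | hy
  · left
    rw [← h']
    conv_rhs => rw [hy]
    simp
  · right
    rw [neg_mul, ← h']
    conv_rhs => rw [hy]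
    simp

/-- Since `t/2` is a root of `-1`, Thue's lemma gives `n = x² + y²`. As `n` is odd, one of `x`, `y`
is even; if it is `y`, swapping the two changes only the sign of the root. -/
theorem exists_four_sq_add_sq {n : ℕ} (hn : 1 < n) (hodd : Odd n) (hsq : Squarefree n) {t : ZMod n}
    (ht : t ^ 2 = (-4 : ℤ)) : ∃ p ∈ {p : ℕ × ℕ | (n : ℤ) = 4 * (p.1 : ℤ) ^ 2 + (p.2 : ℤ) ^ 2},
      (p.2 : ZMod n) = t * p.1 ∨ (p.2 : ZMod n) = -t * p.1 := by
  have h2 : (2 : ZMod n) * (2 : ZMod n)⁻¹ = 1 := by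
    have := ZMod.coe_mul_inv_eq_one (n := n) 2 (Nat.coprime_two_left.2 hodd)
    simpa using this
  push_cast at ht
  have hs : (t * 2⁻¹) ^ 2 = ((-1 : ℤ) : ZMod n) := by
    push_cast
    linear_combination (2⁻¹ : ZMod n) ^ 2 * ht - (2 * 2⁻¹ + 1 : ZMod n) * h2
  obtain ⟨x, y, c, hx, hxn, hyn, hxy, hc⟩ := exists_small_multiple hn hsq hs
  have hx1 : (0 : ℤ) < (x : ℤ) ^ 2 := by positivity
  have hc1 : c = 1 := by
    have : 0 < c := by
      by_contra hc0
      nlinarith [sq_nonneg (y : ℤ)]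
    have : c < 2 := by
      by_contra hc0
      nlinarith
    omega
  subst hc1
  have hc' : y ^ 2 + x ^ 2 = n := by
    zify
    linarith
  rcases Nat.even_or_odd x with he | ho
  · obtain ⟨z, rfl⟩ := he
    refine ⟨(z, y), ?_, ?_⟩
    · simp only [Set.mem_ofPred_eq]
      push_cast [← hc']
      ring
    · push_cast at hxy
      rcases hxy with h | h
      · left
        linear_combination h + (t * z) * h2
      · right
        linear_combination h - (t * z) * h2
  · have he : Even y := by
      by_contra h
      have := (Nat.not_even_iff_odd.1 h).pow (n := 2)
      have h5 := this.add_odd (ho.pow (n := 2))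
      rw [hc'] at h5
      exact Nat.not_even_iff_odd.2 hodd h5
    obtain ⟨z, rfl⟩ := he
    refine ⟨(z, x), ?_, ?_⟩
    · simp only [Set.mem_ofPred_eq]
      push_cast [← hc']
      ring
    · push_cast at hxy hs
      rcases hxy with h | h
      · right
        linear_combination (t * 2⁻¹) * h + x * hs + (-t * z) * h2
      · left
        linear_combination (-t * 2⁻¹) * h + x * hs + (t * z) * h2

theorem exists_three_sq_add_sq {n : ℕ} (hn : 1 < n) (hodd : Odd n) (hsq : Squarefree n)
    {t : ZMod n} (h3 : IsCoprime (3 : ℤ) n) (ht : t ^ 2 = (-3 : ℤ)) :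
    ∃ p ∈ {p : ℕ × ℕ | (n : ℤ) = 3 * (p.1 : ℤ) ^ 2 + (p.2 : ℤ) ^ 2},
      (p.2 : ZMod n) = t * p.1 ∨ (p.2 : ZMod n) = -t * p.1 := by
  obtain ⟨x, y, c, hx, hxn, hyn, hxy, hc⟩ := exists_small_multiple hn hsq ht
  have hx1 : (0 : ℤ) < (x : ℤ) ^ 2 := by positivity
  have hc1 : c = 1 ∨ c = 2 ∨ c = 3 := by
    have : 0 < c := by
      by_contra hc0
      nlinarith [sq_nonneg (y : ℤ)]
    have : c < 4 := by
      by_contra hc0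
      nlinarith
    omega
  rcases hc1 with rfl | rfl | rfl
  · exact ⟨(x, y), by simp only [Set.mem_ofPred_eq]; linarith, hxy⟩
  -- `3x² + y²` is never 2 mod 4.
  · exfalso
    obtain ⟨m, rfl⟩ := hodd
    push_cast at hc
    rcases Int.even_or_odd' (x : ℤ) with ⟨a, ha | ha⟩ <;>
      rcases Int.even_or_odd' (y : ℤ) with ⟨b, hb | hb⟩ <;> rw [ha, hb] at hc <;> ring_nf at hc <;>
        omega
  -- With `y = 3z`, dividing by 3 leaves `n = 3z² + x²`.
  · have h3y : (3 : ℤ) ∣ y := by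
      refine Int.prime_three.dvd_of_dvd_pow (n := 2) ⟨n - x ^ 2, by linarith⟩
    obtain ⟨z, rfl⟩ : 3 ∣ y := by exact_mod_cast h3y
    have h3u : IsUnit ((3 : ℤ) : ZMod n) := (ZMod.coe_int_isUnit_iff_isCoprime 3 n).2 h3.symm
    push_cast at h3u ht hxy hc
    refine ⟨(z, x), by simp only [Set.mem_ofPred_eq]; linarith, ?_⟩
    rcases hxy with h | h
    · right
      apply h3u.mul_left_cancel
      linear_combination t * h + x * ht
    · left
      apply h3u.mul_left_cancel
      linear_combination -t * h + x * ht

theorem exists_three_sq_sub_sq {n : ℕ} (hn : n % 4 = 3) (hsq : Squarefree n) {t : ZMod n}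
    (ht : t ^ 2 = (3 : ℤ)) :
    ∃ p ∈ {p : ℕ × ℕ | (n : ℤ) = 3 * (p.1 : ℤ) ^ 2 - (p.2 : ℤ) ^ 2 ∧ p.2 < p.1},
      (p.2 : ZMod n) = t * p.1 ∨ (p.2 : ZMod n) = -t * p.1 := by
  obtain ⟨x, y, c, hx, hxn, hyn, hxy, hc⟩ := exists_small_multiple (by omega) hsq ht
  have hx1 : (0 : ℤ) < (x : ℤ) ^ 2 := by positivity
  have hc1 : c = -1 ∨ c = 0 ∨ c = -2 := by
    have : c < 1 := by
      by_contra hc0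
      nlinarith
    have : -3 < c := by
      by_contra hc0
      nlinarith [sq_nonneg (y : ℤ)]
    omega
  rcases hc1 with rfl | rfl | rfl
  · have hlt : (y : ℤ) ^ 2 < 2 * (x : ℤ) ^ 2 := by linarith
    rcases lt_trichotomy y x with h | rfl | h
    · exact ⟨(x, y), ⟨by simp only; linarith, h⟩, hxy⟩
    · exfalso
      have : (n : ℤ) = 2 * (y : ℤ) ^ 2 := by linarith
      generalize (y : ℤ) ^ 2 = m at this
      omega
    -- Multiplying `y + x√3` by the unit `2 - √3` gives `(2y - 3x) + (2x - y)√3`, of the same norm.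
    -- The new pair satisfies `v < u` exactly when `x < y` and `3y < 5x`; the latter follows from
    -- `y² < 2x²`.
    · have h53 : 3 * y < 5 * x := by
        zify
        exact lt_of_pow_lt_pow_left₀ 2 (by positivity) (by nlinarith)
      obtain ⟨u, hu⟩ : ∃ u, 2 * x = y + u := Nat.exists_eq_add_of_le (by omega)
      obtain ⟨v, hv⟩ : ∃ v : ℕ, v = (2 * (y : ℤ) - 3 * x).natAbs := ⟨_, rfl⟩
      have hu' : (u : ℤ) = 2 * x - y := by omega
      have hvs : (v : ℤ) ^ 2 = (2 * (y : ℤ) - 3 * x) ^ 2 := by rw [hv, Int.natAbs_sq]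
      refine ⟨(u, v), ⟨?_, by omega⟩, ?_⟩
      · simp only
        rw [hvs, hu']
        linarith
      · have hv' : (v : ℤ) = 2 * y - 3 * x ∨ (v : ℤ) = -(2 * y - 3 * x) := by omega
        have huc := congrArg (Int.cast : ℤ → ZMod n) hu'
        push_cast at huc ht
        simp only [huc]
        rcases hv' with hv' | hv' <;> have hvc := congrArg (Int.cast : ℤ → ZMod n) hv' <;>
          push_cast at hvc <;> rw [hvc] <;> rcases hxy with h | h
        · left; linear_combination (2 + t) * h + x * ht
        · right; linear_combination (2 - t) * h + x * ht
        · right; linear_combination -(2 + t) * h - x * ht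
        · left; linear_combination -(2 - t) * h - x * ht
  · exfalso
    have h3 : IsSquare (3 : ℚ) := ⟨y / x, by
      have hx0 : (x : ℚ) ≠ 0 := by positivity
      field_simp
      have := congrArg (Int.cast : ℤ → ℚ) hc
      push_cast at this
      linarith⟩
    rw [show (3 : ℚ) = ((3 : ℕ) : ℚ) by norm_num, Rat.isSquare_natCast_iff] at h3
    exact Nat.prime_three.prime.irreducible.not_isSquare h3
  -- Now `3x² - y² = 2n` is 6 mod 8, but it is 2 mod 8 for odd `x`, `y`, and odd or divisible by 4
  -- otherwise.
  · exfalso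
    obtain ⟨m, rfl⟩ : ∃ m, n = 4 * m + 3 := ⟨n / 4, by omega⟩
    push_cast at hc
    rcases Int.even_or_odd' (x : ℤ) with ⟨a, ha | ha⟩ <;>
      rcases Int.even_or_odd' (y : ℤ) with ⟨b, hb | hb⟩ <;> rw [ha, hb] at hc
    · ring_nf at hc; omega
    · ring_nf at hc; omega
    · ring_nf at hc; omega
    · obtain ⟨a', ha'⟩ := Int.even_mul_succ_self a
      obtain ⟨b', hb'⟩ := Int.even_mul_succ_self b
      have : 8 * b' - 24 * a' = -8 * m - 4 := by
        linear_combination hc - 4 * hb' + 12 * ha'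
      omega

/-! ### Quadratic reciprocity and the three forms -/

theorem isSquare_three {p : ℕ} (hp : p.Prime) (h : p % 12 = 11) : IsSquare ((3 : ℤ) : ZMod p) := by
  have : Fact p.Prime := ⟨hp⟩
  have h3 := (ZMod.exists_sq_eq_prime_iff_of_mod_four_eq_three (p := p) (q := 3) (by omega)
    (by norm_num) (by omega)).2
  have hp3 : ((p : ℕ) : ZMod 3) = 2 := by
    have : ((p : ℕ) : ZMod 3) = ((2 : ℕ) : ZMod 3) :=
      (ZMod.natCast_eq_natCast_iff' p 2 3).2 (by omega)
    simpa using this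
  have := h3 (by rw [hp3]; decide)
  simpa using this

theorem isSquare_neg_three {p : ℕ} (hp : p.Prime) (h : p % 12 = 7) :
    IsSquare ((-3 : ℤ) : ZMod p) := by
  have : Fact p.Prime := ⟨hp⟩
  have hp3 : ((p : ℕ) : ZMod 3) = 1 := by
    have : ((p : ℕ) : ZMod 3) = ((1 : ℕ) : ZMod 3) :=
      (ZMod.natCast_eq_natCast_iff' p 1 3).2 (by omega)
    simpa using this
  have h30 : ((3 : ℤ) : ZMod p) ≠ 0 := by
    rw [Ne, ZMod.intCast_zmod_eq_zero_iff_dvd]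
    intro hd
    have := Int.le_of_dvd (by norm_num) hd
    have : p ≤ 3 := by exact_mod_cast this
    omega
  have h1 := legendreSym.quadratic_reciprocity_three_mod_four (p := 3) (q := p) (by norm_num)
    (by omega)
  have h2 : legendreSym 3 p = 1 := by
    rw [legendreSym.eq_one_iff'] <;> rw [hp3] <;> decide
  have h4 : legendreSym p (3 : ℕ) = -1 := by rw [h1, h2]
  refine (legendreSym.eq_one_iff p (by push_cast at h30 ⊢; simpa using h30)).1 ?_
  rw [legendreSym.at_neg (by omega), ZMod.χ₄_nat_three_mod_four (by omega)]
  push_cast at h4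
  rw [h4]
  norm_num

theorem isSquare_neg_four {p : ℕ} (hp : p.Prime) (h : p % 4 = 1) :
    IsSquare ((-4 : ℤ) : ZMod p) := by
  have : Fact p.Prime := ⟨hp⟩
  obtain ⟨r, hr⟩ := ZMod.exists_sq_eq_neg_one_iff.2 (by omega : p % 4 ≠ 3)
  exact ⟨2 * r, by push_cast; linear_combination 4 * hr⟩

theorem prime_iff_odd_four_sq_add_sq {n : ℕ} (hn : n % 4 = 1) (hn1 : 1 < n) (hsq : Squarefree n) :
    n.Prime ↔ Odd {p : ℕ × ℕ | (n : ℤ) = 4 * (p.1 : ℤ) ^ 2 + (p.2 : ℤ) ^ 2}.ncard := by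
  have hodd : Odd n := Nat.odd_iff.2 (by omega)
  refine prime_iff_odd_ncard hn1 hodd hsq (D := -4) (s := 1) ?_ (by norm_num) ?_ ?_
    (fun t ht => exists_four_sq_add_sq hn1 hodd hsq ht) fun hp => isSquare_neg_four hp hn
  · exact ⟨n / 4, 1, by omega⟩
  · intro p hp
    simp only [Set.mem_ofPred_eq] at hp
    linarith
  · intro p hp q hq e he h
    simp only [Set.mem_ofPred_eq] at hp hq
    -- The sign `e` is absorbed into the second coordinate of `q`.
    exact eq_of_dvd_of_definite hn1 (D := -4) (by norm_num) (by linarith)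
      (by rw [mul_pow, he]; linarith) h

theorem prime_iff_odd_three_sq_add_sq {n : ℕ} (hn : n % 12 = 7) (hsq : Squarefree n) :
    n.Prime ↔ Odd {p : ℕ × ℕ | (n : ℤ) = 3 * (p.1 : ℤ) ^ 2 + (p.2 : ℤ) ^ 2}.ncard := by
  have hn1 : 1 < n := by omega
  have hodd : Odd n := Nat.odd_iff.2 (by omega)
  refine prime_iff_odd_ncard hn1 hodd hsq (D := -3) (s := 1) ?_ (by norm_num) ?_ ?_
    (fun t ht => exists_three_sq_add_sq hn1 hodd hsq ⟨-(n / 3), 1, by omega⟩ ht)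
    fun hp => isSquare_neg_three hp hn
  · exact ⟨n / 3, 1, by omega⟩
  · intro p hp
    simp only [Set.mem_ofPred_eq] at hp
    linarith
  · intro p hp q hq e he h
    simp only [Set.mem_ofPred_eq] at hp hq
    exact eq_of_dvd_of_definite hn1 (D := -3) (by norm_num) (by linarith)
      (by rw [mul_pow, he]; linarith) h

theorem prime_iff_odd_three_sq_sub_sq {n : ℕ} (hn : n % 12 = 11) (hsq : Squarefree n) :
    n.Prime ↔
      Odd {p : ℕ × ℕ | (n : ℤ) = 3 * (p.1 : ℤ) ^ 2 - (p.2 : ℤ) ^ 2 ∧ p.2 < p.1}.ncard := by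
  have hn1 : 1 < n := by omega
  refine prime_iff_odd_ncard hn1 (Nat.odd_iff.2 (by omega)) hsq (D := 3) (s := -1) ?_ (by norm_num)
    ?_ ?_ (fun t ht => exists_three_sq_sub_sq (by omega) hsq ht) fun hp => isSquare_three hp hn
  · exact ⟨n / 3 + 1, -1, by omega⟩
  · rintro p ⟨hp, -⟩
    linarith
  · rintro p ⟨hp, hp'⟩ q ⟨hq, hq'⟩ e he h
    refine eq_of_dvd_of_three hn1 (by linarith) (by rw [mul_pow, he]; linarith) ?_ ?_ h
    · rw [Nat.abs_cast]
      exact_mod_cast hp'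
    · rcases Int.isUnit_iff.1 (IsUnit.of_pow_eq_one he two_ne_zero) with rfl | rfl <;> simpa using hq'

theorem mainTheorem5 (k : ℕ) (hk : 0 < k) :
    IsPrimeIndex k ↔
      Squarefree (2 * k + 3) ∧
        (((k % 6 = 1 ∨ k % 6 = 5) ∧
            Odd {p : ℕ × ℕ | (k : ℚ) = 2 * (p.1 : ℚ) ^ 2 + ((p.2 : ℚ) ^ 2 - 3) / 2}.ncard) ∨
          (k % 6 = 2 ∧
            Odd {p : ℕ × ℕ | (k : ℚ) = (3 * (p.1 : ℚ) ^ 2 + (p.2 : ℚ) ^ 2 - 3) / 2}.ncard) ∨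
          (k % 6 = 4 ∧
            Odd {p : ℕ × ℕ | (k : ℚ) = (3 * (p.1 : ℚ) ^ 2 - (p.2 : ℚ) ^ 2 - 3) / 2 ∧
              p.2 < p.1}.ncard)) := by
  have ha : {p : ℕ × ℕ | (k : ℚ) = 2 * (p.1 : ℚ) ^ 2 + ((p.2 : ℚ) ^ 2 - 3) / 2} =
      {p : ℕ × ℕ | ((2 * k + 3 : ℕ) : ℤ) = 4 * (p.1 : ℤ) ^ 2 + (p.2 : ℤ) ^ 2} := by
    ext p
    simp only [Set.mem_ofPred_eq]
    rw [← Int.cast_inj (α := ℚ)]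
    push_cast
    constructor <;> intro h <;> linarith
  have hb : {p : ℕ × ℕ | (k : ℚ) = (3 * (p.1 : ℚ) ^ 2 + (p.2 : ℚ) ^ 2 - 3) / 2} =
      {p : ℕ × ℕ | ((2 * k + 3 : ℕ) : ℤ) = 3 * (p.1 : ℤ) ^ 2 + (p.2 : ℤ) ^ 2} := by
    ext p
    simp only [Set.mem_ofPred_eq]
    rw [← Int.cast_inj (α := ℚ)]
    push_cast
    constructor <;> intro h <;> linarith
  have hc : {p : ℕ × ℕ | (k : ℚ) = (3 * (p.1 : ℚ) ^ 2 - (p.2 : ℚ) ^ 2 - 3) / 2 ∧ p.2 < p.1} =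
      {p : ℕ × ℕ | ((2 * k + 3 : ℕ) : ℤ) = 3 * (p.1 : ℤ) ^ 2 - (p.2 : ℤ) ^ 2 ∧ p.2 < p.1} := by
    ext p
    simp only [Set.mem_ofPred_eq]
    rw [← Int.cast_inj (α := ℚ)]
    push_cast
    refine and_congr_left fun _ => ?_
    constructor <;> intro h <;> linarith
  rw [ha, hb, hc, IsPrimeIndex]
  constructor
  · intro hp
    have hsq : Squarefree (2 * k + 3) := hp.prime.irreducible.squarefree
    -- This excludes `k` divisible by 3; `0 < k` rules out the prime 3 itself.
    have h3 : ¬ 3 ∣ 2 * k + 3 := fun h => by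
      have := (Nat.prime_dvd_prime_iff_eq Nat.prime_three hp).1 h
      omega
    refine ⟨hsq, ?_⟩
    have hcases : (k % 6 = 1 ∨ k % 6 = 5) ∨ k % 6 = 2 ∨ k % 6 = 4 := by omega
    rcases hcases with h | h | h
    · exact Or.inl ⟨h, (prime_iff_odd_four_sq_add_sq (by omega) (by omega) hsq).1 hp⟩
    · exact Or.inr (Or.inl ⟨h, (prime_iff_odd_three_sq_add_sq (by omega) hsq).1 hp⟩)
    · exact Or.inr (Or.inr ⟨h, (prime_iff_odd_three_sq_sub_sq (by omega) hsq).1 hp⟩)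
  · rintro ⟨hsq, ⟨h, ho⟩ | ⟨h, ho⟩ | ⟨h, ho⟩⟩
    · exact (prime_iff_odd_four_sq_add_sq (by omega) (by omega) hsq).2 ho
    · exact (prime_iff_odd_three_sq_add_sq (by omega) hsq).2 ho
    · exact (prime_iff_odd_three_sq_sub_sq (by omega) hsq).2 ho
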